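/- A finite dynamical system (FDS) is a function $A : S_A \to S_A$ on a finite (possibly empty) set $S_A$; FDSs are considered up to isomorphism, that is, up to bijections of the state sets commuting with the functions. The set $\mathbb{D}$ of FDSs is a commutative semiring: $A+B$ acts as $A$ and as $B$ on the two parts of the disjoint union $S_A \sqcup S_B$, and $AB$ acts on $S_A \times S_B$ by $(a,b) \mapsto (A(a),B(b))$. An FDS $A$ is cancellative if, for all $X, Y \in \mathbb{D}$, $AX = AY$ implies $X = Y$; let $\mathbb{D}^*$ be the set of cancellative FDSs. An FDS $A$ has a fixpoint if $A(s) = s$ for some $s \in S_A$. Let $P = \sum_i a_i X^i \in \mathbb{D}[X]$ be a polynomial and let $A, B \in \mathbb{D}$ be such that $P(A) = P(B)$. Then: 1. if $a_1 \in \mathbb{D}^*$, then $A = B$; 2. if $a_i \in \mathbb{D}^*$ for some $i > 1$ and $A \in \mathbb{D}^*$, then $A = B$. Moreover, the same holds with "has a fixpoint" in place of "belongs to $\mathbb{D}^*$": 3. if $a_1$ has a fixpoint, then $A = B$; 4. if $a_i$ has a fixpoint for some $i > 1$ and $A$ has a fixpoint, then $A = B$. -/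

import Mathlib

/-- A concrete finite dynamical system: a function from a finite set into itself.
The empty set is allowed. -/
structure FinDynSys where
  State : Type
  [finite : Finite State]
  map : State → State

namespace FinDynSys

attribute [instance] FinDynSys.finite

/-- An isomorphism of systems: a bijection of the state sets that commutes with the dynamics,
that is, an isomorphism of the functional graphs. -/
def Iso (A B : FinDynSys) : Prop :=
  ∃ e : A.State ≃ B.State, ∀ x, e (A.map x) = B.map (e x)

theorem Iso.refl (A : FinDynSys) : Iso A A := ⟨Equiv.refl _, fun _ => rfl⟩

theorem Iso.symm {A B : FinDynSys} : Iso A B → Iso B A := by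
  rintro ⟨e, he⟩
  exact ⟨e.symm, fun x => by rw [Equiv.symm_apply_eq, he, Equiv.apply_symm_apply]⟩

theorem Iso.trans {A B C : FinDynSys} : Iso A B → Iso B C → Iso A C := by
  rintro ⟨e, he⟩ ⟨f, hf⟩
  exact ⟨e.trans f, fun x => by simp [he, hf]⟩

instance setoid : Setoid FinDynSys := ⟨Iso, Iso.refl, Iso.symm, Iso.trans⟩

/-- The sum: the two systems side by side on the disjoint union of the state sets. -/
def sum (A B : FinDynSys) : FinDynSys := ⟨A.State ⊕ B.State, Sum.map A.map B.map⟩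

/-- The product: the two systems running in parallel on the Cartesian product. -/
def prod (A B : FinDynSys) : FinDynSys := ⟨A.State × B.State, Prod.map A.map B.map⟩

/-- The empty function. -/
def empty : FinDynSys := ⟨Empty, id⟩

/-- The unique function from a one-point set to itself. -/
def point : FinDynSys := ⟨Unit, id⟩

theorem Iso.sum {A A' B B' : FinDynSys} :
    Iso A A' → Iso B B' → Iso (A.sum B) (A'.sum B') := by
  rintro ⟨e, he⟩ ⟨f, hf⟩
  refine ⟨Equiv.sumCongr e f, ?_⟩
  rintro (x | x)
  · exact congrArg Sum.inl (he x)
  · exact congrArg Sum.inr (hf x)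

theorem Iso.prod {A A' B B' : FinDynSys} :
    Iso A A' → Iso B B' → Iso (A.prod B) (A'.prod B') := by
  rintro ⟨e, he⟩ ⟨f, hf⟩
  exact ⟨Equiv.prodCongr e f, fun x => Prod.ext (he x.1) (hf x.2)⟩

/-- The system has a fixpoint. -/
def HasFixpoint (A : FinDynSys) : Prop := ∃ x, A.map x = x

theorem Iso.hasFixpoint {A B : FinDynSys} : Iso A B → A.HasFixpoint → B.HasFixpoint := by
  rintro ⟨e, he⟩ ⟨x, hx⟩
  exact ⟨e x, by rw [← he, hx]⟩

end FinDynSys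

/-- The set `𝔻` of finite dynamical systems, considered up to isomorphism. -/
def FDS : Type 1 := Quotient FinDynSys.setoid

namespace FDS

/-- The isomorphism class of a concrete system. -/
def mk (A : FinDynSys) : FDS := Quotient.mk _ A

instance : Add FDS :=
  ⟨Quotient.map₂ FinDynSys.sum fun _ _ h _ _ h' => FinDynSys.Iso.sum h h'⟩

instance : Mul FDS :=
  ⟨Quotient.map₂ FinDynSys.prod fun _ _ h _ _ h' => FinDynSys.Iso.prod h h'⟩

instance : Zero FDS := ⟨mk FinDynSys.empty⟩

instance : One FDS := ⟨mk FinDynSys.point⟩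

/-- The semiring of finite dynamical systems; powers and natural multiples are the iterated
products and sums. -/
instance : CommSemiring FDS where
  add_assoc := by
    rintro ⟨A⟩ ⟨B⟩ ⟨C⟩
    exact Quotient.sound ⟨Equiv.sumAssoc _ _ _, by rintro ((x | x) | x) <;> rfl⟩
  zero_add := by
    rintro ⟨A⟩
    exact Quotient.sound ⟨Equiv.emptySum Empty _, by rintro (x | x); exacts [x.elim, rfl]⟩
  add_zero := by
    rintro ⟨A⟩
    exact Quotient.sound ⟨Equiv.sumEmpty _ Empty, by rintro (x | x); exacts [rfl, x.elim]⟩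
  add_comm := by
    rintro ⟨A⟩ ⟨B⟩
    exact Quotient.sound ⟨Equiv.sumComm _ _, by rintro (x | x) <;> rfl⟩
  mul_assoc := by
    rintro ⟨A⟩ ⟨B⟩ ⟨C⟩
    exact Quotient.sound ⟨Equiv.prodAssoc _ _ _, fun _ => rfl⟩
  one_mul := by
    rintro ⟨A⟩
    exact Quotient.sound ⟨Equiv.punitProd _, fun _ => rfl⟩
  mul_one := by
    rintro ⟨A⟩
    exact Quotient.sound ⟨Equiv.prodPUnit _, fun _ => rfl⟩
  mul_comm := by
    rintro ⟨A⟩ ⟨B⟩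
    exact Quotient.sound ⟨Equiv.prodComm _ _, fun _ => rfl⟩
  zero_mul := by
    rintro ⟨A⟩
    exact Quotient.sound ⟨Equiv.equivOfIsEmpty (Empty × A.State) Empty, fun x => x.1.elim⟩
  mul_zero := by
    rintro ⟨A⟩
    exact Quotient.sound ⟨Equiv.equivOfIsEmpty (A.State × Empty) Empty, fun x => x.2.elim⟩
  left_distrib := by
    rintro ⟨A⟩ ⟨B⟩ ⟨C⟩
    exact Quotient.sound ⟨Equiv.prodSumDistrib _ _ _, by rintro ⟨a, x | x⟩ <;> rfl⟩
  right_distrib := by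
    rintro ⟨A⟩ ⟨B⟩ ⟨C⟩
    exact Quotient.sound ⟨Equiv.sumProdDistrib _ _ _, by rintro ⟨x | x, c⟩ <;> rfl⟩
  nsmul := nsmulRec
  npow := npowRec

/-- Having a fixpoint, as a property of an isomorphism class of systems. -/
def HasFixpoint : FDS → Prop :=
  Quotient.lift FinDynSys.HasFixpoint fun _ _ h =>
    propext ⟨FinDynSys.Iso.hasFixpoint h, FinDynSys.Iso.hasFixpoint (FinDynSys.Iso.symm h)⟩

/-- An FDS `A` is cancellative if `A X = A Y` implies `X = Y`. -/
def IsCancellative (A : FDS) : Prop := ∀ X Y : FDS, A * X = A * Y → X = Y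

end FDS

/-! For a connected system `T`, the number of morphisms `T → A` is additive and multiplicative in
`A`, hence a semiring homomorphism `FDS →+* ℕ` (`homCount`). By Lovász's theorem these homomorphisms
jointly separate systems (`ext_homCount`). Each sends a system with a fixpoint to a positive number,
through the constant morphism, so `P` becomes a strictly increasing polynomial over `ℕ` and the
counts of `A` and `B` agree. The cancellative case reduces to this one: a system without fixpoint is
not cancellative (`exists_mul_eq_mul_of_not_hasFixpoint`), because each component maps to a cycle of
length `n > 1` and cannot tell that cycle from `n` fixpoints. -/

namespace FinDynSys

/-- The morphisms of systems: the maps that commute with the dynamics. -/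
def Hom (A B : FinDynSys) : Type :=
  {φ : A.State → B.State // ∀ x, φ (A.map x) = B.map (φ x)}

instance (A B : FinDynSys) : Finite (A.Hom B) := by unfold Hom; infer_instance

/-- The injective morphisms of systems. -/
def Emb (A B : FinDynSys) : Type := {φ : A.Hom B // Function.Injective φ.1}

instance (A B : FinDynSys) : Finite (A.Emb B) := by unfold Emb; infer_instance

/-- A morphism commutes with iterates of the dynamics. -/
theorem Hom.iterate {A B : FinDynSys} (φ : A.Hom B) (n : ℕ) (x : A.State) :
    φ.1 (A.map^[n] x) = B.map^[n] (φ.1 x) :=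
  (Function.Semiconj.iterate_right (fun y => φ.2 y) n) x

/-- A morphism set depends only on the isomorphism classes of source and target. -/
theorem Iso.card_hom {A A' B B' : FinDynSys} (hA : Iso A A') (hB : Iso B B') :
    Nat.card (A.Hom B) = Nat.card (A'.Hom B') := by
  obtain ⟨e, he⟩ := hA
  obtain ⟨f, hf⟩ := hB
  have he' : ∀ x, e.symm (A'.map x) = A.map (e.symm x) := fun x => by
    rw [Equiv.symm_apply_eq, he, Equiv.apply_symm_apply]
  refine Nat.card_congr ((Equiv.arrowCongr e f).subtypeEquiv fun φ => ?_)
  simp only [Equiv.arrowCongr_apply, Function.comp_apply]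
  constructor
  · intro h x
    rw [he', h, hf]
  · intro h x
    apply f.injective
    have := h (e x)
    rwa [← he, Equiv.symm_apply_apply, Equiv.symm_apply_apply, ← hf] at this

theorem card_hom_prod (T A B : FinDynSys) :
    Nat.card (T.Hom (A.prod B)) = Nat.card (T.Hom A) * Nat.card (T.Hom B) := by
  rw [← Nat.card_prod]
  refine Nat.card_congr
    { toFun := fun φ => (⟨fun x => (φ.1 x).1, fun x => congrArg Prod.fst (φ.2 x)⟩,
        ⟨fun x => (φ.1 x).2, fun x => congrArg Prod.snd (φ.2 x)⟩)
      invFun := fun p => ⟨fun x => (p.1.1 x, p.2.1 x),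
        fun x => Prod.ext (p.1.2 x) (p.2.2 x)⟩
      left_inv := fun _ => rfl
      right_inv := fun _ => rfl }

theorem card_hom_point (T : FinDynSys) : Nat.card (T.Hom point) = 1 := by
  have : Unique (T.Hom point) :=
    { default := ⟨fun _ => (), fun _ => rfl⟩
      uniq := fun _ => rfl }
  exact Nat.card_unique

theorem card_sum_hom (S T A : FinDynSys) :
    Nat.card ((S.sum T).Hom A) = Nat.card (S.Hom A) * Nat.card (T.Hom A) := by
  rw [← Nat.card_prod]
  refine Nat.card_congr
    { toFun := fun φ => (⟨fun x => φ.1 (Sum.inl x), fun x => φ.2 (Sum.inl x)⟩,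
        ⟨fun x => φ.1 (Sum.inr x), fun x => φ.2 (Sum.inr x)⟩)
      invFun := fun p => ⟨Sum.elim p.1.1 p.2.1, by
        rintro (x | x)
        exacts [p.1.2 x, p.2.2 x]⟩
      left_inv := fun φ => Subtype.ext (by funext x; rcases x with x | x <;> rfl)
      right_inv := fun _ => rfl }

/-- The system is connected: it has a state whose orbit meets every orbit. -/
def Connected (A : FinDynSys) : Prop :=
  ∃ x, ∀ y, ∃ m n, A.map^[m] y = A.map^[n] x

/-- The side of a disjoint union is preserved by the dynamics. -/
theorem isLeft_iterate_sum (A B : FinDynSys) (n : ℕ) (z : (A.sum B).State) :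
    Sum.isLeft ((A.sum B).map^[n] z) = Sum.isLeft z := by
  induction n generalizing z with
  | zero => rfl
  | succ n ih =>
    rw [Function.iterate_succ_apply, ih]
    rcases z with z | z <;> rfl

/-- A morphism from a connected system to a sum has its image in one of the summands. -/
theorem Connected.hom_sum_cases {T : FinDynSys} (hT : T.Connected) {A B : FinDynSys}
    (φ : T.Hom (A.sum B)) :
    (∃ α : T.Hom A, ∀ y, φ.1 y = Sum.inl (α.1 y)) ∨
      ∃ β : T.Hom B, ∀ y, φ.1 y = Sum.inr (β.1 y) := by
  obtain ⟨x, hx⟩ := hT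
  have key : ∀ y, Sum.isLeft (φ.1 y) = Sum.isLeft (φ.1 x) := by
    intro y
    obtain ⟨m, n, h⟩ := hx y
    rw [← isLeft_iterate_sum A B m, ← φ.iterate, h, φ.iterate, isLeft_iterate_sum]
  cases h : Sum.isLeft (φ.1 x) with
  | true =>
    left
    have : ∀ y, ∃ a, φ.1 y = Sum.inl a := fun y => Sum.isLeft_iff.1 ((key y).trans h)
    choose α hα using this
    refine ⟨⟨α, fun y => Sum.inl_injective (β := B.State) ?_⟩, hα⟩
    rw [← hα, φ.2, hα]
    rfl
  | false =>
    right
    have : ∀ y, ∃ b, φ.1 y = Sum.inr b := fun y =>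
      Sum.isRight_iff.1 (Sum.isLeft_eq_false.1 ((key y).trans h))
    choose β hβ using this
    refine ⟨⟨β, fun y => Sum.inr_injective (α := A.State) ?_⟩, hβ⟩
    rw [← hβ, φ.2, hβ]
    rfl

theorem Connected.card_hom_sum {T : FinDynSys} (hT : T.Connected) (A B : FinDynSys) :
    Nat.card (T.Hom (A.sum B)) = Nat.card (T.Hom A) + Nat.card (T.Hom B) := by
  rw [← Nat.card_sum]
  symm
  let F : T.Hom A ⊕ T.Hom B → T.Hom (A.sum B) :=
    Sum.elim (fun α => ⟨fun y => Sum.inl (α.1 y), fun y => congrArg Sum.inl (α.2 y)⟩)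
      (fun β => ⟨fun y => Sum.inr (β.1 y), fun y => congrArg Sum.inr (β.2 y)⟩)
  refine Nat.card_congr (Equiv.ofBijective F ⟨?_, ?_⟩)
  · obtain ⟨x, -⟩ := hT
    rintro (α | α) (β | β) h
    · exact congrArg Sum.inl (Subtype.ext (funext fun y =>
        Sum.inl_injective (congrFun (congrArg Subtype.val h) y)))
    · exact absurd (congrFun (congrArg Subtype.val h) x) Sum.inl_ne_inr
    · exact absurd (congrFun (congrArg Subtype.val h) x) Sum.inr_ne_inl
    · exact congrArg Sum.inr (Subtype.ext (funext fun y =>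
        Sum.inr_injective (congrFun (congrArg Subtype.val h) y)))
  · intro φ
    rcases hT.hom_sum_cases φ with ⟨α, hα⟩ | ⟨β, hβ⟩
    · exact ⟨Sum.inl α, Subtype.ext (funext fun y => (hα y).symm)⟩
    · exact ⟨Sum.inr β, Subtype.ext (funext fun y => (hβ y).symm)⟩

theorem Connected.card_hom_empty {T : FinDynSys} (hT : T.Connected) :
    Nat.card (T.Hom empty) = 0 := by
  obtain ⟨x, -⟩ := hT
  have : IsEmpty (T.Hom empty) := ⟨fun φ => (φ.1 x).elim⟩
  exact Nat.card_of_isEmpty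

/-- The restriction of a system to an invariant set of states. -/
def restrict (A : FinDynSys) (S : Set A.State) (hS : ∀ x ∈ S, A.map x ∈ S) : FinDynSys :=
  ⟨S, fun x => ⟨A.map x, hS x x.2⟩⟩

theorem coe_iterate_restrict (A : FinDynSys) (S : Set A.State) (hS : ∀ x ∈ S, A.map x ∈ S)
    (n : ℕ) (x : S) : Subtype.val (p := (· ∈ S)) ((A.restrict S hS).map^[n] x) = A.map^[n] x.1 :=
  Hom.iterate (A := A.restrict S hS) (B := A) ⟨Subtype.val, fun _ => rfl⟩ n x

theorem iso_restrict_sum (A : FinDynSys) (S : Set A.State) (hS : ∀ x ∈ S, A.map x ∈ S)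
    (hS' : ∀ x ∈ Sᶜ, A.map x ∈ Sᶜ) :
    Iso ((A.restrict S hS).sum (A.restrict Sᶜ hS')) A := by
  classical
  refine ⟨Equiv.Set.sumCompl S, ?_⟩
  rintro (x | x) <;> rfl

/-- Induction along the decomposition of a system into connected components. -/
theorem component_induction {p : FinDynSys → Prop} (hiso : ∀ A B, Iso A B → p A → p B)
    (h0 : p empty) (hadd : ∀ K A, Connected K → p A → p (K.sum A)) (A : FinDynSys) : p A := by
  induction hn : Nat.card A.State using Nat.strong_induction_on generalizing A with
  | _ n ih =>
  subst hn
  rcases isEmpty_or_nonempty A.State with hA | ⟨⟨x⟩⟩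
  · exact hiso _ _ ⟨Equiv.equivOfIsEmpty Empty A.State, fun x => Empty.elim x⟩ h0
  -- The connected component of `x`: the states whose orbit meets that of `x`.
  let S : Set A.State := {y | ∃ m n, A.map^[m] y = A.map^[n] x}
  have hS : ∀ y ∈ S, A.map y ∈ S := by
    rintro y ⟨m, n, h⟩
    refine ⟨m, n + 1, ?_⟩
    rw [Function.iterate_succ_apply', ← h, ← Function.iterate_succ_apply,
      Function.iterate_succ_apply']
  have hS' : ∀ y ∈ Sᶜ, A.map y ∈ Sᶜ := by
    rintro y hy ⟨m, n, h⟩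
    exact hy ⟨m + 1, n, h⟩
  have hx : x ∈ S := ⟨0, 0, rfl⟩
  refine hiso _ _ (A.iso_restrict_sum S hS hS') (hadd _ _ ⟨⟨x, hx⟩, ?_⟩ (ih _ ?_ _ rfl))
  · rintro ⟨y, m, n, h⟩
    refine ⟨m, n, Subtype.ext ?_⟩
    rw [coe_iterate_restrict, coe_iterate_restrict]
    exact h
  · exact Finite.card_subtype_lt (p := fun y => y ∈ Sᶜ) (x := x) fun h => h hx

end FinDynSys

/-! ### Lovász's theorem -/

namespace FinDynSys

/-- The congruences of a system. -/
def Congr (T : FinDynSys) : Type :=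
  {r : Setoid T.State // ∀ x y, r x y → r (T.map x) (T.map y)}

instance (T : FinDynSys) : Finite T.Congr :=
  Finite.of_injective (β := T.State → T.State → Prop) (fun r => fun x y => r.1 x y)
    fun _ _ h => Subtype.ext (Setoid.ext fun x y => iff_of_eq (congrFun (congrFun h x) y))

/-- The quotient of a system by a congruence. -/
def quot (T : FinDynSys) (r : T.Congr) : FinDynSys :=
  ⟨Quotient r.1, Quotient.map T.map r.2⟩

/-- The discrete congruence. -/
def Congr.bot (T : FinDynSys) : T.Congr := ⟨⊥, fun _ _ h => congrArg T.map h⟩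

theorem iso_quot_bot (T : FinDynSys) : Iso T (T.quot (Congr.bot T)) := by
  refine ⟨Equiv.ofBijective (fun x => Quotient.mk _ x) ⟨fun x y h => ?_, Quotient.mk_surjective⟩,
    fun _ => rfl⟩
  exact Quotient.exact h

theorem card_quot_lt (T : FinDynSys) {r : T.Congr} (hr : r ≠ Congr.bot T) :
    Nat.card (T.quot r).State < Nat.card T.State := by
  refine lt_of_le_of_ne (Nat.card_le_card_of_surjective _ (Quotient.mk_surjective (s := r.1)))
    fun h => hr ?_
  have hb := (Quotient.mk_surjective (s := r.1)).bijective_of_nat_card_le h.ge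
  refine Subtype.ext (Setoid.ext fun x y => ⟨fun hxy => hb.1 (Quotient.sound hxy), ?_⟩)
  rintro rfl
  exact r.1.refl _

theorem Iso.card_emb {T T' : FinDynSys} (h : Iso T T') (A : FinDynSys) :
    Nat.card (T.Emb A) = Nat.card (T'.Emb A) := by
  obtain ⟨e, he⟩ := h
  have he' : ∀ x, e.symm (T'.map x) = T.map (e.symm x) := fun x => by
    rw [Equiv.symm_apply_eq, he, Equiv.apply_symm_apply]
  refine Nat.card_congr
    { toFun := fun φ => ⟨⟨fun x => φ.1.1 (e.symm x), fun x => ?_⟩, φ.2.comp e.symm.injective⟩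
      invFun := fun φ => ⟨⟨fun x => φ.1.1 (e x), fun x => ?_⟩, φ.2.comp e.injective⟩
      left_inv := fun φ => ?_
      right_inv := fun φ => ?_ }
  · exact (congrArg φ.1.1 (he' x)).trans (φ.1.2 _)
  · exact (congrArg φ.1.1 (he x)).trans (φ.1.2 _)
  · exact Subtype.ext (Subtype.ext (funext fun x => congrArg φ.1.1 (e.symm_apply_apply x)))
  · exact Subtype.ext (Subtype.ext (funext fun x => congrArg φ.1.1 (e.apply_symm_apply x)))

/-- The kernel congruence of a morphism. -/
def Hom.ker {T A : FinDynSys} (φ : T.Hom A) : T.Congr :=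
  ⟨Setoid.ker φ.1, fun x y h => by
    rw [Setoid.ker_def] at h ⊢
    rw [φ.2, φ.2, h]⟩

/-- Morphisms with a given kernel are the injective morphisms from the quotient. -/
def homWithKerEquiv (T A : FinDynSys) (r : T.Congr) :
    {φ : T.Hom A // φ.ker = r} ≃ (T.quot r).Emb A where
  toFun φ := ⟨⟨Quotient.lift φ.1.1 fun x y h => by
      have h' : φ.1.ker.1 x y := by rw [φ.2]; exact h
      exact h', by rintro ⟨x⟩; exact φ.1.2 x⟩, by
    rintro ⟨x⟩ ⟨y⟩ h
    have h' : φ.1.ker.1 x y := h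
    rw [φ.2] at h'
    exact Quotient.sound h'⟩
  invFun ψ := ⟨⟨fun x => ψ.1.1 (Quotient.mk _ x), fun x => ψ.1.2 (Quotient.mk _ x)⟩,
    Subtype.ext (Setoid.ext fun x y =>
      ⟨fun h => Quotient.exact (ψ.2 h), fun h => congrArg ψ.1.1 (Quotient.sound h)⟩)⟩
  left_inv _ := rfl
  right_inv ψ := Subtype.ext (Subtype.ext (by funext x; rcases x with ⟨x⟩; rfl))

theorem card_hom_eq_sum_card_emb (T A : FinDynSys) [Fintype T.Congr] :
    Nat.card (T.Hom A) = ∑ r : T.Congr, Nat.card ((T.quot r).Emb A) := by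
  rw [← Nat.card_sigma]
  exact Nat.card_congr ((Equiv.sigmaFiberEquiv Hom.ker).symm.trans
    (Equiv.sigmaCongrRight fun r => homWithKerEquiv T A r))

/-- Sorting morphisms by kernel, the discrete kernel contributes the injective ones, and every other
term concerns a strictly smaller quotient, settled by induction. -/
theorem card_emb_eq_of_card_hom_eq {A B : FinDynSys}
    (h : ∀ T : FinDynSys, Nat.card (T.Hom A) = Nat.card (T.Hom B)) (T : FinDynSys) :
    Nat.card (T.Emb A) = Nat.card (T.Emb B) := by
  classical
  induction hn : Nat.card T.State using Nat.strong_induction_on generalizing T with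
  | _ n ih =>
  subst hn
  have := Fintype.ofFinite T.Congr
  have hT := h T
  rw [card_hom_eq_sum_card_emb, card_hom_eq_sum_card_emb,
    ← Finset.add_sum_erase _ _ (Finset.mem_univ (Congr.bot T)),
    ← Finset.add_sum_erase _ _ (Finset.mem_univ (Congr.bot T)),
    Finset.sum_congr rfl fun r hr =>
      ih _ (T.card_quot_lt (Finset.ne_of_mem_erase hr)) (T.quot r) rfl] at hT
  rw [T.iso_quot_bot.card_emb, T.iso_quot_bot.card_emb]
  exact Nat.add_right_cancel hT

/-- Lovász's theorem: a system is determined by the numbers of morphisms into it. -/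
theorem iso_of_card_hom_eq {A B : FinDynSys}
    (h : ∀ T : FinDynSys, Nat.card (T.Hom A) = Nat.card (T.Hom B)) : Iso A B := by
  have key : ∀ A B : FinDynSys, Nat.card (A.Emb A) = Nat.card (A.Emb B) →
      Nonempty (A.Emb B) := by
    intro A B h
    have : Nonempty (A.Emb A) := ⟨⟨⟨id, fun _ => rfl⟩, Function.injective_id⟩⟩
    exact (Nat.card_pos_iff.1 (h ▸ Nat.card_pos)).1
  obtain ⟨φ⟩ := key A B (card_emb_eq_of_card_hom_eq h A)
  obtain ⟨ψ⟩ := key B A (card_emb_eq_of_card_hom_eq (fun T => (h T).symm) B)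
  -- Injections both ways between finite sets make `φ` bijective.
  exact ⟨Equiv.ofBijective φ.1.1
    (φ.2.bijective_of_nat_card_le (Nat.card_le_card_of_injective _ ψ.2)), φ.1.2⟩

/-- Morphisms out of a sum are pairs of morphisms, so the counts from the components determine all
counts. -/
theorem iso_of_card_hom_eq_of_connected {A B : FinDynSys}
    (h : ∀ T : FinDynSys, T.Connected → Nat.card (T.Hom A) = Nat.card (T.Hom B)) : Iso A B := by
  refine iso_of_card_hom_eq fun T => ?_
  induction T using component_induction with
  | hiso S T hST hS =>
    rw [← hST.card_hom (Iso.refl A), ← hST.card_hom (Iso.refl B), hS]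
  | h0 =>
    have (C : FinDynSys) : Unique (empty.Hom C) :=
      { default := ⟨fun x => x.elim, fun x => x.elim⟩
        uniq := fun _ => Subtype.ext (funext fun x => x.elim) }
    rw [Nat.card_unique, Nat.card_unique]
  | hadd K T hK hT => rw [card_sum_hom, card_sum_hom, h K hK, hT]

/-! ### Cycles and systems without fixpoint -/

/-- The cycle of length `n`, for `n` positive. -/
def cycle (n : ℕ) [NeZero n] : FinDynSys := ⟨ZMod n, fun x => x + 1⟩

/-- The system of `n` fixpoints, for `n` positive. -/
def points (n : ℕ) [NeZero n] : FinDynSys := ⟨ZMod n, id⟩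

/-- The shear `(x, i) ↦ (x, i - φ x)` cancels the rotation, since both `i` and `φ x` advance by one
at each step. -/
theorem Hom.iso_prod_cycle {K : FinDynSys} {n : ℕ} [NeZero n] (φ : K.Hom (cycle n)) :
    Iso (K.prod (cycle n)) (K.prod (points n)) := by
  let f : K.State → ZMod n := φ.1
  have hf : ∀ x, f (K.map x) = f x + 1 := φ.2
  refine ⟨Equiv.prodShear (Equiv.refl K.State) fun x => (Equiv.subRight (f x) : ZMod n ≃ ZMod n), ?_⟩
  rintro ⟨x, i⟩
  refine Prod.ext rfl ?_
  suffices ∀ j : ZMod n, j + 1 - f (K.map x) = j - f x from this i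
  intro j
  rw [hf]
  ring

/-- A connected system without fixpoint maps to a cycle of length at least two. -/
theorem Connected.exists_hom_cycle {K : FinDynSys} (hK : K.Connected) (h : ¬ K.HasFixpoint) :
    ∃ (n : ℕ) (_ : NeZero n), 1 < n ∧ Nonempty (K.Hom (cycle n)) := by
  obtain ⟨x, hx⟩ := hK
  obtain ⟨p, hp, hxp⟩ : ∃ p, p ∈ Function.periodicPts K.map ∧ ∃ k, K.map^[k] x = p := by
    obtain ⟨i, j, hij, hne⟩ := Finite.exists_ne_map_eq_of_infinite fun k : ℕ => K.map^[k] x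
    wlog hlt : i < j generalizing i j
    · exact this j i hij.symm hne.symm (lt_of_le_of_ne (not_lt.1 hlt) hij.symm)
    refine ⟨_, Function.mk_mem_periodicPts (Nat.sub_pos_of_lt hlt) ?_, i, rfl⟩
    change K.map^[j - i] (K.map^[i] x) = K.map^[i] x
    rw [← Function.iterate_add_apply, Nat.sub_add_cancel hlt.le]
    exact hne.symm
  set n := Function.minimalPeriod K.map p
  have hpos : 0 < n := Function.minimalPeriod_pos_of_mem_periodicPts hp
  have : NeZero n := ⟨hpos.ne'⟩
  have hreach : ∀ y, ∃ m, K.map^[m] y = p := by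
    intro y
    obtain ⟨k, rfl⟩ := hxp
    obtain ⟨a, b, hab⟩ := hx y
    obtain ⟨c, hc⟩ : ∃ c, b ≤ c ∧ K.map^[c] x = K.map^[k] x := by
      -- The periodic point recurs every `n` steps; `b` extra turns make the exponent at least `b`.
      refine ⟨n * b + k, Nat.le_add_right_of_le (Nat.le_mul_of_pos_left b hpos), ?_⟩
      rw [Function.iterate_add_apply]
      exact (Function.isPeriodicPt_minimalPeriod K.map _).mul_const b
    refine ⟨c - b + a, ?_⟩
    rw [Function.iterate_add_apply, hab, ← Function.iterate_add_apply,
      Nat.sub_add_cancel hc.1, hc.2]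
  have huniq : ∀ y a b, K.map^[a] y = p → K.map^[b] y = p → (a : ZMod n) = b := by
    have aux : ∀ y a b, a ≤ b → K.map^[a] y = p → K.map^[b] y = p → (a : ZMod n) = b := by
      intro y a b hab ha hb
      rw [ZMod.natCast_eq_natCast_iff]
      refine (Nat.modEq_iff_dvd' hab).2 (Function.IsPeriodicPt.minimalPeriod_dvd ?_)
      change K.map^[b - a] p = p
      rw [← ha, ← Function.iterate_add_apply, Nat.sub_add_cancel hab, hb, ha]
    intro y a b ha hb
    rcases le_total a b with hab | hab
    · exact aux y a b hab ha hb
    · exact (aux y b a hab hb ha).symm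
  choose m hm using hreach
  -- `m y` steps lead from `y` to `p`, and modulo `n` each step lowers this number by one; hence the
  -- sign.
  refine ⟨n, ‹_›, ?_, ⟨⟨fun y => (-(m y : ZMod n) : ZMod n), fun y => ?_⟩⟩⟩
  · refine lt_of_le_of_ne hpos fun h1 => h ⟨p, ?_⟩
    exact Function.minimalPeriod_eq_one_iff_isFixedPt.1 h1.symm
  · change -(m (K.map y) : ZMod n) = -(m y : ZMod n) + 1
    rw [huniq y (m y) (m (K.map y) + 1) (hm y) (hm (K.map y))]
    push_cast
    ring

end FinDynSys

/-! ### Morphism counts and cancellation -/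

namespace FDS

open FinDynSys

/-- The number of morphisms from a connected system, as a homomorphism of semirings. -/
noncomputable def homCount (T : FinDynSys) (hT : T.Connected) : FDS →+* ℕ where
  toFun := Quotient.lift (fun A => Nat.card (T.Hom A)) fun _ _ h => (Iso.refl T).card_hom h
  map_one' := T.card_hom_point
  map_mul' := by
    rintro ⟨A⟩ ⟨B⟩
    exact T.card_hom_prod A B
  map_zero' := hT.card_hom_empty
  map_add' := by
    rintro ⟨A⟩ ⟨B⟩
    exact hT.card_hom_sum A B

theorem ext_homCount {A B : FDS} (h : ∀ T hT, homCount T hT A = homCount T hT B) : A = B := by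
  rcases A with ⟨A⟩
  rcases B with ⟨B⟩
  exact Quotient.sound (iso_of_card_hom_eq_of_connected h)

theorem HasFixpoint.homCount_pos {A : FDS} (hA : A.HasFixpoint) (T : FinDynSys)
    (hT : T.Connected) : 0 < homCount T hT A := by
  rcases A with ⟨A⟩
  obtain ⟨x, hx⟩ := hA
  have : Nonempty (T.Hom A) := ⟨⟨fun _ => x, fun _ => hx.symm⟩⟩
  exact Nat.card_pos (α := T.Hom A)

theorem connected_point : point.Connected := ⟨(), fun _ => ⟨0, 0, rfl⟩⟩

/-- A system without fixpoint takes the same product with two systems that have different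
numbers of fixpoints. -/
theorem exists_mul_eq_mul_of_not_hasFixpoint (A : FinDynSys) (hA : ¬ A.HasFixpoint) :
    ∃ X Y : FDS, mk A * X = mk A * Y ∧
      homCount point connected_point X ≠ homCount point connected_point Y := by
  induction A using component_induction with
  | hiso A B hAB ih =>
    have hmk : mk A = mk B := Quotient.sound hAB
    rw [← hmk]
    exact ih fun h => hA (hAB.hasFixpoint h)
  | h0 =>
    refine ⟨0, 1, ?_, ?_⟩
    · change (0 : FDS) * 0 = 0 * 1
      rw [zero_mul, zero_mul]
    · rw [map_zero, map_one]
      exact zero_ne_one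
  | hadd K A hK ih =>
    obtain ⟨X, Y, hXY, hne⟩ := ih fun ⟨x, hx⟩ => hA ⟨Sum.inr x, congrArg Sum.inr hx⟩
    obtain ⟨n, _, hn, ⟨φ⟩⟩ := hK.exists_hom_cycle fun ⟨x, hx⟩ =>
      hA ⟨Sum.inl x, congrArg Sum.inl hx⟩
    have hmk : mk (K.sum A) = mk K + mk A := rfl
    have hcyc : mk K * mk (cycle n) = mk K * mk (points n) := Quotient.sound φ.iso_prod_cycle
    have hc : homCount point connected_point (mk (cycle n)) = 0 := by
      have : Fact (1 < n) := ⟨hn⟩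
      have : IsEmpty (point.Hom (cycle n)) := ⟨fun ψ => by
        let z : ZMod n := ψ.1 ()
        have h : z = z + 1 := ψ.2 ()
        exact one_ne_zero (left_eq_add.1 h)⟩
      exact Nat.card_of_isEmpty (α := point.Hom (cycle n))
    have hp : homCount point connected_point (mk (points n)) ≠ 0 :=
      (HasFixpoint.homCount_pos (A := mk (points n)) ⟨(0 : ZMod n), rfl⟩ _ _).ne'
    -- Formally the two differ by `(cycle n - points n) * (X - Y)`: `K` kills the first factor, `A`
    -- the second. A cycle with `n > 1` has no fixpoint, so the fixpoint counts still differ.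
    refine ⟨mk (cycle n) * X + mk (points n) * Y, mk (cycle n) * Y + mk (points n) * X, ?_, ?_⟩
    · calc mk (K.sum A) * (mk (cycle n) * X + mk (points n) * Y)
          = (mk K * mk (cycle n)) * X + (mk K * mk (points n)) * Y
            + ((mk A * X) * mk (cycle n) + (mk A * Y) * mk (points n)) := by rw [hmk]; ring
        _ = (mk K * mk (points n)) * X + (mk K * mk (cycle n)) * Y
            + ((mk A * Y) * mk (cycle n) + (mk A * X) * mk (points n)) := by rw [hcyc, hXY]
        _ = mk (K.sum A) * (mk (cycle n) * Y + mk (points n) * X) := by rw [hmk]; ring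
    · simp only [map_add, map_mul, hc, zero_mul, zero_add]
      exact fun h => hne (mul_left_cancel₀ hp h).symm

theorem IsCancellative.hasFixpoint {A : FDS} (hA : A.IsCancellative) : A.HasFixpoint := by
  rcases A with ⟨A⟩
  by_contra h
  obtain ⟨X, Y, hXY, hne⟩ := exists_mul_eq_mul_of_not_hasFixpoint A h
  exact hne (congrArg _ (hA X Y hXY))

end FDS

/-! ### Injectivity of polynomials -/

theorem Polynomial.strictMono_eval_nat {Q : Polynomial ℕ} {i : ℕ} (hi : i ≠ 0)
    (hQ : 0 < Q.coeff i) : StrictMono fun x => Q.eval x := by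
  intro x y hxy
  simp only [Polynomial.eval_eq_sum_range]
  refine Finset.sum_lt_sum (fun j _ => by gcongr) ⟨i, ?_, ?_⟩
  · rw [Finset.mem_range, Nat.lt_succ_iff]
    exact Polynomial.le_natDegree_of_ne_zero hQ.ne'
  · exact Nat.mul_lt_mul_of_pos_left (Nat.pow_lt_pow_left hxy hi) hQ

/-- A polynomial with a coefficient of positive degree that has a fixpoint is injective. -/
theorem FDS.eq_of_eval_eq_eval {P : Polynomial FDS} {A B : FDS} (hP : P.eval A = P.eval B)
    {i : ℕ} (hi : i ≠ 0) (h : (P.coeff i).HasFixpoint) : A = B := by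
  refine FDS.ext_homCount fun T hT => ?_
  have hQ : 0 < (P.map (FDS.homCount T hT)).coeff i := by
    rw [Polynomial.coeff_map]
    exact h.homCount_pos T hT
  refine (Polynomial.strictMono_eval_nat hi hQ).injective ?_
  simp only [Polynomial.eval_map, Polynomial.eval₂_at_apply, hP]

theorem mainTheorem5 (P : Polynomial FDS) (A B : FDS) (hP : P.eval A = P.eval B) :
    ((P.coeff 1).IsCancellative → A = B) ∧
    ((∃ i, 1 < i ∧ (P.coeff i).IsCancellative) → A.IsCancellative → A = B) ∧
    ((P.coeff 1).HasFixpoint → A = B) ∧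
    ((∃ i, 1 < i ∧ (P.coeff i).HasFixpoint) → A.HasFixpoint → A = B) := by
  refine ⟨fun h => FDS.eq_of_eval_eq_eval hP one_ne_zero h.hasFixpoint, ?_,
    FDS.eq_of_eval_eq_eval hP one_ne_zero, ?_⟩
  · rintro ⟨i, hi, h⟩ -
    exact FDS.eq_of_eval_eq_eval hP (by lia) h.hasFixpoint
  · rintro ⟨i, hi, h⟩ -
    exact FDS.eq_of_eval_eq_eval hP (by lia) h
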